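/- Let $\mathfrak A$ be a $C^*$-algebra and let $H,K,E$ be Hilbert $\mathfrak A$-modules; $\mathcal L(H,K)$ denotes the adjointable operators from $H$ to $K$, $\mathcal L(H)=\mathcal L(H,H)$, and $\mathcal R(T)$, $\mathcal N(T)$ denote the range and the null space of an operator $T$. A weight on $H$ is a self-adjoint operator that is invertible in $\mathcal L(H)$; a positive weight is called positive definite. For weights $M\in\mathcal L(K)$, $N\in\mathcal L(H)$ and $A\in\mathcal L(H,K)$, the weighted Moore–Penrose inverse $A^\dagger_{MN}$, if it exists, is the unique $X\in\mathcal L(K,H)$ with $AXA=A$, $XAX=X$, $(MAX)^*=MAX$, $(NXA)^*=NXA$. Put $A^\dagger=A^\dagger_{I_KI_H}$; $A$ is called M-P invertible if $A^\dagger$ exists. Let $A\in\mathcal L(H,K)$ and $B\in\mathcal L(H,E)$ be such that $A$ and $A^*A+B^*B$ are both M-P invertible, and let $V\in\mathcal L(K)$ and $W\in\mathcal L(E)$ be positive definite. Let $\Omega_{A,B,W}$ be the set of all $U\in\mathcal L(H)$ of the form $$U=A^*XA+B^*WB+Y\,P_{\mathcal N(A)\cap\mathcal N(B)},$$ where $P_{\mathcal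 N(A)\cap\mathcal N(B)}$ is the projection from $H$ onto $\mathcal N(A)\cap\mathcal N(B)$, $Y$ is a positive definite operator on $\mathcal N(A)\cap\mathcal N(B)$, and $X\in\mathcal L(K)$ is a self-adjoint operator such that the restriction of $A^*XA+B^*WB$ to $\mathcal R(A^*A+B^*B)$ is a positive definite operator on $\mathcal R(A^*A+B^*B)$. Then for every $U\in\Omega_{A,B,W}$: the operator $A^*VA+tB^*WB$ is M-P invertible for every $t>0$, $U$ is positive definite, $A^\dagger_{VU}$ exists, and $$\lim_{t\to0^+}\left(A^*VA+tB^*WB\right)^\dagger A^*V=A^\dagger_{VU}$$ in the operator-norm topology. -/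

import Mathlib

open Filter Topology

noncomputable section

/-!
Hilbert `C⋆`-modules are Mathlib's `CStarModule`s that are complete.  Mathlib writes the action of
the algebra on the left, with `⟪x, a • y⟫ = a * ⟪x, y⟫`; a right Hilbert module over a
`C⋆`-algebra is the same thing as such a module over the opposite `C⋆`-algebra.
-/

section InnerLemmas

variable {𝔄 H : Type*} [NonUnitalCStarAlgebra 𝔄] [PartialOrder 𝔄]
  [NormedAddCommGroup H] [NormedSpace ℂ H] [SMul 𝔄 H] [CStarModule 𝔄 H]

variable (𝔄) in
/-- The `𝔄`-valued inner product separates points. -/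
theorem CStarModule.ext_of_inner {x y : H} (h : ∀ z : H, inner 𝔄 z x = inner 𝔄 z y) :
    x = y := by
  have h1 : inner 𝔄 (x - y) (x - y) = 0 := by
    rw [CStarModule.inner_sub_right, h, sub_self]
  exact sub_eq_zero.mp (CStarModule.inner_self.mp h1)

end InnerLemmas

/-- `𝓛(H, K)`: the adjointable operators between Hilbert `𝔄`-modules, that is, operators `T`
together with an operator `T⋆` with `⟪T x, y⟫ = ⟪x, T⋆ y⟫`.  The operator `T⋆` is determined by `T`
(see `AdjointableOp.ext_of_apply`), and `𝔄`-linearity of `T` is automatic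
(see `AdjointableOp.map_alg_smul`). -/
structure AdjointableOp (𝔄 H K : Type*) [NonUnitalCStarAlgebra 𝔄] [PartialOrder 𝔄]
    [NormedAddCommGroup H] [NormedSpace ℂ H] [SMul 𝔄 H] [CStarModule 𝔄 H]
    [NormedAddCommGroup K] [NormedSpace ℂ K] [SMul 𝔄 K] [CStarModule 𝔄 K] where
  /-- the underlying bounded operator -/
  toCLM : H →L[ℂ] K
  /-- the underlying bounded operator of the adjoint -/
  adjCLM : K →L[ℂ] H
  inner_apply_left : ∀ (x : H) (y : K), inner 𝔄 (toCLM x) y = inner 𝔄 x (adjCLM y)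

namespace AdjointableOp

variable {𝔄 H K E F : Type*} [NonUnitalCStarAlgebra 𝔄] [PartialOrder 𝔄]
  [NormedAddCommGroup H] [NormedSpace ℂ H] [SMul 𝔄 H] [CStarModule 𝔄 H]
  [NormedAddCommGroup K] [NormedSpace ℂ K] [SMul 𝔄 K] [CStarModule 𝔄 K]
  [NormedAddCommGroup E] [NormedSpace ℂ E] [SMul 𝔄 E] [CStarModule 𝔄 E]

instance : CoeFun (AdjointableOp 𝔄 H K) (fun _ => H → K) := ⟨fun T => T.toCLM⟩

theorem ext_of_apply {S T : AdjointableOp 𝔄 H K} (h : ∀ x, S x = T x) : S = T := by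
  have h1 : S.toCLM = T.toCLM := ContinuousLinearMap.ext h
  have h2 : S.adjCLM = T.adjCLM := by
    ext y
    refine CStarModule.ext_of_inner 𝔄 fun z => ?_
    rw [← S.inner_apply_left, ← T.inner_apply_left, h1]
  cases S
  cases T
  simp_all

/-- The adjoint `T⋆`. -/
def adj (T : AdjointableOp 𝔄 H K) : AdjointableOp 𝔄 K H where
  toCLM := T.adjCLM
  adjCLM := T.toCLM
  inner_apply_left x y := by
    rw [← CStarModule.star_inner, ← T.inner_apply_left, CStarModule.star_inner]

theorem map_alg_smul (T : AdjointableOp 𝔄 H K) (a : 𝔄) (x : H) : T (a • x) = a • T x := by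
  refine CStarModule.ext_of_inner 𝔄 fun z => ?_
  have h (u : H) : inner 𝔄 z (T u) = inner 𝔄 (T.adj z) u := (T.adj.inner_apply_left z u).symm
  rw [h, CStarModule.inner_op_smul_right, CStarModule.inner_op_smul_right, h]

variable (𝔄 H) in
/-- The identity operator `I_H`. -/
def one : AdjointableOp 𝔄 H H where
  toCLM := ContinuousLinearMap.id ℂ H
  adjCLM := ContinuousLinearMap.id ℂ H
  inner_apply_left _ _ := rfl

/-- The product `S T` of operators. -/
def comp (S : AdjointableOp 𝔄 K E) (T : AdjointableOp 𝔄 H K) : AdjointableOp 𝔄 H E where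
  toCLM := S.toCLM.comp T.toCLM
  adjCLM := T.adjCLM.comp S.adjCLM
  inner_apply_left x y := by
    simp [S.inner_apply_left, T.inner_apply_left]

instance : Add (AdjointableOp 𝔄 H K) where
  add S T :=
    { toCLM := S.toCLM + T.toCLM
      adjCLM := S.adjCLM + T.adjCLM
      inner_apply_left := fun x y => by
        simp [S.inner_apply_left, T.inner_apply_left] }

instance : SMul ℂ (AdjointableOp 𝔄 H K) where
  smul c T :=
    { toCLM := c • T.toCLM
      adjCLM := star c • T.adjCLM
      inner_apply_left := fun x y => by
        simp [T.inner_apply_left] }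

end AdjointableOp

infixr:80 " ∘ₐ " => AdjointableOp.comp

namespace AdjointableOp

variable {𝔄 H K E : Type*} [NonUnitalCStarAlgebra 𝔄] [PartialOrder 𝔄]
  [NormedAddCommGroup H] [NormedSpace ℂ H] [SMul 𝔄 H] [CStarModule 𝔄 H]
  [NormedAddCommGroup K] [NormedSpace ℂ K] [SMul 𝔄 K] [CStarModule 𝔄 K]
  [NormedAddCommGroup E] [NormedSpace ℂ E] [SMul 𝔄 E] [CStarModule 𝔄 E]

/-- `T = T⋆`. -/
def IsSelfAdj (T : AdjointableOp 𝔄 H H) : Prop := T.adj = T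

/-- `T` is invertible in `𝓛(H)`. -/
def IsInvertible (T : AdjointableOp 𝔄 H H) : Prop :=
  ∃ S : AdjointableOp 𝔄 H H, S ∘ₐ T = one 𝔄 H ∧ T ∘ₐ S = one 𝔄 H

/-- `T` is a positive element of the `C⋆`-algebra `𝓛(H)`. -/
def IsPos (T : AdjointableOp 𝔄 H H) : Prop :=
  ∃ S : AdjointableOp 𝔄 H H, T = S.adj ∘ₐ S

/-- A weight is a self-adjoint invertible operator. -/
def IsWeight (M : AdjointableOp 𝔄 H H) : Prop := M.IsSelfAdj ∧ M.IsInvertible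

/-- A positive definite operator is a positive weight. -/
def IsPosDef (M : AdjointableOp 𝔄 H H) : Prop := M.IsWeight ∧ M.IsPos

/-- `X` is the weighted Moore-Penrose inverse of `A` with respect to the weights `M`, `N`. -/
structure IsWMPInverse (M : AdjointableOp 𝔄 K K) (N : AdjointableOp 𝔄 H H)
    (A : AdjointableOp 𝔄 H K) (X : AdjointableOp 𝔄 K H) : Prop where
  mul_mul_left : A ∘ₐ X ∘ₐ A = A
  mul_mul_right : X ∘ₐ A ∘ₐ X = X
  left_selfAdj : (M ∘ₐ A ∘ₐ X).IsSelfAdj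
  right_selfAdj : (N ∘ₐ X ∘ₐ A).IsSelfAdj

/-- `A†_{MN}` exists. -/
def WMPInvertible (M : AdjointableOp 𝔄 K K) (N : AdjointableOp 𝔄 H H)
    (A : AdjointableOp 𝔄 H K) : Prop :=
  ∃ X, IsWMPInverse M N A X

/-- `A` is Moore-Penrose invertible: `A†` exists. -/
def MPInvertible (A : AdjointableOp 𝔄 H K) : Prop :=
  WMPInvertible (one 𝔄 K) (one 𝔄 H) A

/-- The weighted Moore-Penrose inverse `A†_{MN}`, which is unique (`IsWMPInverse.unique`); the
value is `A⋆`, without meaning, if `A†_{MN}` does not exist. -/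
def wmpInv (M : AdjointableOp 𝔄 K K) (N : AdjointableOp 𝔄 H H) (A : AdjointableOp 𝔄 H K) :
    AdjointableOp 𝔄 K H :=
  open Classical in if h : WMPInvertible M N A then h.choose else A.adj

/-- The Moore-Penrose inverse `A†`. -/
def mpInv (A : AdjointableOp 𝔄 H K) : AdjointableOp 𝔄 K H :=
  wmpInv (one 𝔄 K) (one 𝔄 H) A

theorem adj_comp (S : AdjointableOp 𝔄 K E) (T : AdjointableOp 𝔄 H K) :
    (S ∘ₐ T).adj = T.adj ∘ₐ S.adj := rfl

/-- Two operators that absorb each other on the right, and that are self-adjoint for the indefinite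
inner product of an invertible `M`, agree. -/
theorem eq_of_weighted_selfAdj {M P Q : AdjointableOp 𝔄 H H} (hM : M.IsWeight)
    (hP : (M ∘ₐ P).IsSelfAdj) (hQ : (M ∘ₐ Q).IsSelfAdj) (h1 : Q ∘ₐ P = P) (h2 : P ∘ₐ Q = Q) :
    P = Q := by
  obtain ⟨hMs, M', hM'1, -⟩ := hM
  unfold IsSelfAdj at hMs hP hQ
  rw [adj_comp, hMs] at hP hQ
  have key : M ∘ₐ P = M ∘ₐ Q := by
    calc M ∘ₐ P = P.adj ∘ₐ M := hP.symm
      _ = (Q ∘ₐ P).adj ∘ₐ M := by rw [h1]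
      _ = P.adj ∘ₐ (Q.adj ∘ₐ M) := rfl
      _ = P.adj ∘ₐ (M ∘ₐ Q) := by rw [hQ]
      _ = (P.adj ∘ₐ M) ∘ₐ Q := rfl
      _ = (M ∘ₐ P) ∘ₐ Q := by rw [hP]
      _ = M ∘ₐ (P ∘ₐ Q) := rfl
      _ = M ∘ₐ Q := by rw [h2]
  calc P = one 𝔄 H ∘ₐ P := rfl
    _ = M' ∘ₐ (M ∘ₐ P) := by rw [← hM'1]; rfl
    _ = M' ∘ₐ (M ∘ₐ Q) := by rw [key]
    _ = (M' ∘ₐ M) ∘ₐ Q := rfl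
    _ = Q := by rw [hM'1]; rfl

theorem eq_of_weighted_selfAdj' {N P Q : AdjointableOp 𝔄 H H} (hN : N.IsWeight)
    (hP : (N ∘ₐ P).IsSelfAdj) (hQ : (N ∘ₐ Q).IsSelfAdj) (h1 : P ∘ₐ Q = P) (h2 : Q ∘ₐ P = Q) :
    P = Q := by
  obtain ⟨hNs, N', hN'1, -⟩ := hN
  unfold IsSelfAdj at hNs hP hQ
  rw [adj_comp, hNs] at hP hQ
  have key : N ∘ₐ P = N ∘ₐ Q := by
    calc N ∘ₐ P = P.adj ∘ₐ N := hP.symm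
      _ = (P ∘ₐ Q).adj ∘ₐ N := by rw [h1]
      _ = Q.adj ∘ₐ (P.adj ∘ₐ N) := rfl
      _ = Q.adj ∘ₐ (N ∘ₐ P) := by rw [hP]
      _ = (Q.adj ∘ₐ N) ∘ₐ P := rfl
      _ = (N ∘ₐ Q) ∘ₐ P := by rw [hQ]
      _ = N ∘ₐ (Q ∘ₐ P) := rfl
      _ = N ∘ₐ Q := by rw [h2]
  calc P = one 𝔄 H ∘ₐ P := rfl
    _ = N' ∘ₐ (N ∘ₐ P) := by rw [← hN'1]; rfl
    _ = N' ∘ₐ (N ∘ₐ Q) := by rw [key]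
    _ = (N' ∘ₐ N) ∘ₐ Q := rfl
    _ = Q := by rw [hN'1]; rfl

theorem IsWMPInverse.unique {M : AdjointableOp 𝔄 K K} {N : AdjointableOp 𝔄 H H}
    {A : AdjointableOp 𝔄 H K} {X Z : AdjointableOp 𝔄 K H} (hM : M.IsWeight) (hN : N.IsWeight)
    (hX : IsWMPInverse M N A X) (hZ : IsWMPInverse M N A Z) : X = Z := by
  have hA1 : A ∘ₐ X = A ∘ₐ Z :=
    eq_of_weighted_selfAdj hM hX.left_selfAdj hZ.left_selfAdj
      (congrArg (fun T => T ∘ₐ X) hZ.mul_mul_left) (congrArg (fun T => T ∘ₐ Z) hX.mul_mul_left)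
  have hA2 : X ∘ₐ A = Z ∘ₐ A :=
    eq_of_weighted_selfAdj' hN hX.right_selfAdj hZ.right_selfAdj
      (congrArg (fun T => X ∘ₐ T) hZ.mul_mul_left) (congrArg (fun T => Z ∘ₐ T) hX.mul_mul_left)
  calc X = X ∘ₐ (A ∘ₐ X) := hX.mul_mul_right.symm
    _ = (X ∘ₐ A) ∘ₐ Z := by rw [hA1]; rfl
    _ = Z ∘ₐ A ∘ₐ Z := by rw [hA2]; rfl
    _ = Z := hZ.mul_mul_right

end AdjointableOp

/-- Complex subspaces of `H` that are stable under the action of `𝔄`. -/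
structure AlgSubmodule (𝔄 H : Type*) [NormedAddCommGroup H] [NormedSpace ℂ H] [SMul 𝔄 H]
    extends Submodule ℂ H where
  alg_smul_mem : ∀ (a : 𝔄) {x : H}, x ∈ carrier → a • x ∈ carrier

namespace AlgSubmodule

variable {𝔄 H : Type*} [NonUnitalCStarAlgebra 𝔄] [PartialOrder 𝔄]
  [NormedAddCommGroup H] [NormedSpace ℂ H] [SMul 𝔄 H] [CStarModule 𝔄 H]

instance instSMulAlg (S : AlgSubmodule 𝔄 H) : SMul 𝔄 S.toSubmodule where
  smul a x := ⟨a • (x : H), S.alg_smul_mem a x.2⟩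

/-- A submodule carries the inner product of `H`; it is a Hilbert module if it is closed. -/
instance instCStarModule (S : AlgSubmodule 𝔄 H) : CStarModule 𝔄 S.toSubmodule where
  inner x y := inner 𝔄 (x : H) (y : H)
  inner_add_right := CStarModule.inner_add_right
  inner_self_nonneg := CStarModule.inner_self_nonneg
  inner_self := by
    intro x
    exact CStarModule.inner_self.trans (by simp)
  inner_op_smul_right := CStarModule.inner_op_smul_right
  inner_smul_right_complex := CStarModule.inner_smul_right_complex
  star_inner _ _ := CStarModule.star_inner _ _
  norm_eq_sqrt_norm_inner_self x := CStarModule.norm_eq_sqrt_norm_inner_self (x : H)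

instance : Min (AlgSubmodule 𝔄 H) where
  min S T :=
    { toSubmodule := S.toSubmodule ⊓ T.toSubmodule
      alg_smul_mem := fun a _ hx => ⟨S.alg_smul_mem a hx.1, T.alg_smul_mem a hx.2⟩ }

end AlgSubmodule

namespace AdjointableOp

variable {𝔄 H K E : Type*} [NonUnitalCStarAlgebra 𝔄] [PartialOrder 𝔄]
  [NormedAddCommGroup H] [NormedSpace ℂ H] [SMul 𝔄 H] [CStarModule 𝔄 H]
  [NormedAddCommGroup K] [NormedSpace ℂ K] [SMul 𝔄 K] [CStarModule 𝔄 K]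
  [NormedAddCommGroup E] [NormedSpace ℂ E] [SMul 𝔄 E] [CStarModule 𝔄 E]

/-- The null space `𝓝(T)`. -/
def nullSpace (T : AdjointableOp 𝔄 H K) : AlgSubmodule 𝔄 H where
  toSubmodule := LinearMap.ker (T.toCLM : H →ₗ[ℂ] K)
  alg_smul_mem a x hx := by
    have hx' : T x = 0 := hx
    change T (a • x) = 0
    refine CStarModule.ext_of_inner 𝔄 fun z => ?_
    rw [map_alg_smul, CStarModule.inner_op_smul_right, hx']
    simp

/-- The range `𝓡(T)`.  It is closed if `T` is Moore-Penrose invertible. -/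
def range (T : AdjointableOp 𝔄 H K) : AlgSubmodule 𝔄 K where
  toSubmodule := LinearMap.range (T.toCLM : H →ₗ[ℂ] K)
  alg_smul_mem a x hx := by
    obtain ⟨y, rfl⟩ := hx
    exact ⟨a • y, T.map_alg_smul a y⟩

/-- The restriction of `T ∈ 𝓛(H)` to the submodule `S` is a positive definite operator on `S`. -/
def IsPosDefOn (T : AdjointableOp 𝔄 H H) (S : AlgSubmodule 𝔄 H) : Prop :=
  ∃ T₀ : AdjointableOp 𝔄 S.toSubmodule S.toSubmodule,
    (∀ x : S.toSubmodule, (T₀ x : H) = T x) ∧ T₀.IsPosDef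

/-- `P` is the projection from `H` onto the submodule `S`. -/
structure IsProjOnto (P : AdjointableOp 𝔄 H H) (S : AlgSubmodule 𝔄 H) : Prop where
  idem : P ∘ₐ P = P
  selfAdj : P.IsSelfAdj
  apply_mem : ∀ x, P x ∈ S.toSubmodule
  apply_of_mem : ∀ x ∈ S.toSubmodule, P x = x

/-- The set `Ω_{A,B,W}` of all operators `U = A⋆ X A + B⋆ W B + Y P`, where `P` is the projection
from `H` onto `𝓝(A) ∩ 𝓝(B)`, `Y` is a positive definite operator on `𝓝(A) ∩ 𝓝(B)`, and `X` is a
self-adjoint operator on `K` such that the restriction of `A⋆ X A + B⋆ W B` to `𝓡(A⋆ A + B⋆ B)`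
is a positive definite operator on `𝓡(A⋆ A + B⋆ B)`. -/
def Omega (A : AdjointableOp 𝔄 H K) (B : AdjointableOp 𝔄 H E) (W : AdjointableOp 𝔄 E E) :
    Set (AdjointableOp 𝔄 H H) :=
  {U | ∃ (X : AdjointableOp 𝔄 K K)
        (Y : AdjointableOp 𝔄 (A.nullSpace ⊓ B.nullSpace).toSubmodule
          (A.nullSpace ⊓ B.nullSpace).toSubmodule)
        (P : AdjointableOp 𝔄 H H) (hP : P.IsProjOnto (A.nullSpace ⊓ B.nullSpace)),
      X.IsSelfAdj ∧
      (A.adj ∘ₐ X ∘ₐ A + B.adj ∘ₐ W ∘ₐ B).IsPosDefOn (A.adj ∘ₐ A + B.adj ∘ₐ B).range ∧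
      Y.IsPosDef ∧
      ∀ h : H, U h = (A.adj ∘ₐ X ∘ₐ A + B.adj ∘ₐ W ∘ₐ B) h + (Y ⟨P h, hP.apply_mem h⟩ : H)}

end AdjointableOp

end

noncomputable section

namespace AdjointableOp

section Algebra

variable {𝔄 H K E F : Type*} [NonUnitalCStarAlgebra 𝔄] [PartialOrder 𝔄]
  [NormedAddCommGroup H] [NormedSpace ℂ H] [SMul 𝔄 H] [CStarModule 𝔄 H]
  [NormedAddCommGroup K] [NormedSpace ℂ K] [SMul 𝔄 K] [CStarModule 𝔄 K]
  [NormedAddCommGroup E] [NormedSpace ℂ E] [SMul 𝔄 E] [CStarModule 𝔄 E]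
  [NormedAddCommGroup F] [NormedSpace ℂ F] [SMul 𝔄 F] [CStarModule 𝔄 F]

theorem toCLM_injective :
    Function.Injective (toCLM : AdjointableOp 𝔄 H K → H →L[ℂ] K) :=
  fun _ _ h => ext_of_apply fun x => congrArg (fun f : H →L[ℂ] K => f x) h

instance : Zero (AdjointableOp 𝔄 H K) where
  zero := ⟨0, 0, fun x y => by simp⟩

instance : Neg (AdjointableOp 𝔄 H K) where
  neg T := ⟨-T.toCLM, -T.adjCLM, fun x y => by simp [T.inner_apply_left]⟩

instance : Sub (AdjointableOp 𝔄 H K) where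
  sub S T := ⟨S.toCLM - T.toCLM, S.adjCLM - T.adjCLM, fun x y => by
    simp [S.inner_apply_left, T.inner_apply_left]⟩

instance : SMul ℕ (AdjointableOp 𝔄 H K) where
  smul n T := ⟨n • T.toCLM, n • T.adjCLM, fun x y => by
    simp only [← Nat.cast_smul_eq_nsmul ℂ]
    simp [T.inner_apply_left]⟩

instance : SMul ℤ (AdjointableOp 𝔄 H K) where
  smul n T := ⟨n • T.toCLM, n • T.adjCLM, fun x y => by
    simp only [← Int.cast_smul_eq_zsmul ℂ]
    simp [T.inner_apply_left]⟩

instance instAddCommGroup : AddCommGroup (AdjointableOp 𝔄 H K) :=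
  toCLM_injective.addCommGroup _ rfl (fun _ _ => rfl) (fun _ => rfl) (fun _ _ => rfl)
    (fun _ _ => rfl) (fun _ _ => rfl)

/-- Forgetting the adjoint, as an additive map. -/
def toCLMHom : AdjointableOp 𝔄 H K →+ (H →L[ℂ] K) where
  toFun := toCLM
  map_zero' := rfl
  map_add' _ _ := rfl

instance instModule : Module ℂ (AdjointableOp 𝔄 H K) :=
  toCLM_injective.module ℂ (toCLMHom (𝔄 := 𝔄) (H := H) (K := K)) fun _ _ => rfl

instance instNormedAddCommGroup : NormedAddCommGroup (AdjointableOp 𝔄 H K) :=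
  NormedAddCommGroup.induced _ _ (toCLMHom (𝔄 := 𝔄) (H := H) (K := K)) toCLM_injective

theorem norm_def (T : AdjointableOp 𝔄 H K) : ‖T‖ = ‖T.toCLM‖ := rfl

instance instNormedSpace : NormedSpace ℂ (AdjointableOp 𝔄 H K) where
  norm_smul_le c T := norm_smul_le c T.toCLM

@[simp] theorem zero_apply (x : H) : (0 : AdjointableOp 𝔄 H K) x = 0 := rfl

@[simp] theorem add_apply (S T : AdjointableOp 𝔄 H K) (x : H) : (S + T) x = S x + T x := rfl

@[simp] theorem comp_apply (S : AdjointableOp 𝔄 K E) (T : AdjointableOp 𝔄 H K) (x : H) :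
    (S ∘ₐ T) x = S (T x) := rfl

theorem comp_assoc (R : AdjointableOp 𝔄 E F) (S : AdjointableOp 𝔄 K E) (T : AdjointableOp 𝔄 H K) :
    (R ∘ₐ S) ∘ₐ T = R ∘ₐ S ∘ₐ T := rfl

@[simp] theorem one_comp (T : AdjointableOp 𝔄 H K) : one 𝔄 K ∘ₐ T = T := rfl

@[simp] theorem comp_one (T : AdjointableOp 𝔄 H K) : T ∘ₐ one 𝔄 H = T := rfl

theorem comp_add (R : AdjointableOp 𝔄 K E) (S T : AdjointableOp 𝔄 H K) :
    R ∘ₐ (S + T) = R ∘ₐ S + R ∘ₐ T := ext_of_apply fun _ => map_add R.toCLM _ _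

theorem comp_sub (R : AdjointableOp 𝔄 K E) (S T : AdjointableOp 𝔄 H K) :
    R ∘ₐ (S - T) = R ∘ₐ S - R ∘ₐ T := ext_of_apply fun _ => map_sub R.toCLM _ _

theorem add_comp (R S : AdjointableOp 𝔄 K E) (T : AdjointableOp 𝔄 H K) :
    (R + S) ∘ₐ T = R ∘ₐ T + S ∘ₐ T := ext_of_apply fun _ => rfl

theorem sub_comp (R S : AdjointableOp 𝔄 K E) (T : AdjointableOp 𝔄 H K) :
    (R - S) ∘ₐ T = R ∘ₐ T - S ∘ₐ T := ext_of_apply fun _ => rfl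

@[simp] theorem comp_zero (R : AdjointableOp 𝔄 K E) :
    R ∘ₐ (0 : AdjointableOp 𝔄 H K) = 0 := ext_of_apply fun _ => map_zero R.toCLM

@[simp] theorem zero_comp (T : AdjointableOp 𝔄 H K) :
    (0 : AdjointableOp 𝔄 K E) ∘ₐ T = 0 := ext_of_apply fun _ => rfl

theorem comp_smul (c : ℂ) (S : AdjointableOp 𝔄 K E) (T : AdjointableOp 𝔄 H K) :
    S ∘ₐ (c • T) = c • (S ∘ₐ T) := ext_of_apply fun _ => map_smul S.toCLM c _

theorem smul_comp (c : ℂ) (S : AdjointableOp 𝔄 K E) (T : AdjointableOp 𝔄 H K) :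
    (c • S) ∘ₐ T = c • (S ∘ₐ T) := ext_of_apply fun _ => rfl

theorem adj_smul (c : ℂ) (T : AdjointableOp 𝔄 H K) : (c • T).adj = star c • T.adj :=
  ext_of_apply fun _ => rfl

theorem norm_comp_le (S : AdjointableOp 𝔄 K E) (T : AdjointableOp 𝔄 H K) :
    ‖S ∘ₐ T‖ ≤ ‖S‖ * ‖T‖ := S.toCLM.opNorm_comp_le T.toCLM

instance instRing : Ring (AdjointableOp 𝔄 H H) where
  __ := instAddCommGroup
  mul := comp
  one := one 𝔄 H
  left_distrib := comp_add
  right_distrib := add_comp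
  zero_mul := zero_comp
  mul_zero := comp_zero
  mul_assoc := comp_assoc
  one_mul := one_comp
  mul_one := comp_one

theorem mul_eq_comp (S T : AdjointableOp 𝔄 H H) : S * T = S ∘ₐ T := rfl

theorem one_eq : (1 : AdjointableOp 𝔄 H H) = one 𝔄 H := rfl

instance instNormedRing : NormedRing (AdjointableOp 𝔄 H H) where
  __ := instNormedAddCommGroup
  __ := instRing
  norm_mul_le := norm_comp_le

instance instAlgebra : Algebra ℂ (AdjointableOp 𝔄 H H) :=
  Algebra.ofModule (fun c S T => smul_comp c S T) (fun c S T => comp_smul c S T)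

instance instNormedAlgebra : NormedAlgebra ℂ (AdjointableOp 𝔄 H H) where
  norm_smul_le c T := norm_smul_le c T.toCLM

instance instStarRing : StarRing (AdjointableOp 𝔄 H H) where
  star := adj
  star_involutive _ := rfl
  star_mul _ _ := rfl
  star_add _ _ := rfl

theorem star_eq_adj (T : AdjointableOp 𝔄 H H) : star T = T.adj := rfl

instance instStarModule : StarModule ℂ (AdjointableOp 𝔄 H H) where
  star_smul c T := adj_smul c T

end Algebra

section CStar

variable {𝔄 H K : Type*} [NonUnitalCStarAlgebra 𝔄] [PartialOrder 𝔄] [StarOrderedRing 𝔄]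
  [NormedAddCommGroup H] [NormedSpace ℂ H] [SMul 𝔄 H] [CStarModule 𝔄 H]
  [NormedAddCommGroup K] [NormedSpace ℂ K] [SMul 𝔄 K] [CStarModule 𝔄 K]

theorem norm_sq_le_norm_adj_comp_self (T : AdjointableOp 𝔄 H K) :
    ‖T‖ * ‖T‖ ≤ ‖T.adj ∘ₐ T‖ := by
  have h (x : H) : ‖T x‖ ≤ √‖T.adj ∘ₐ T‖ * ‖x‖ := by
    refine le_of_sq_le_sq ?_ (by positivity)
    rw [mul_pow, Real.sq_sqrt (norm_nonneg _), CStarModule.norm_sq_eq 𝔄 (x := T x),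
      T.inner_apply_left]
    calc _ ≤ ‖x‖ * ‖(T.adj ∘ₐ T) x‖ := CStarModule.norm_inner_le H
      _ ≤ ‖x‖ * (‖T.adj ∘ₐ T‖ * ‖x‖) := by
        gcongr
        exact (T.adj ∘ₐ T).toCLM.le_opNorm x
      _ = _ := by ring
  have h2 : ‖T‖ ≤ √‖T.adj ∘ₐ T‖ := T.toCLM.opNorm_le_bound (Real.sqrt_nonneg _) h
  calc ‖T‖ * ‖T‖ ≤ √‖T.adj ∘ₐ T‖ * √‖T.adj ∘ₐ T‖ := by gcongr
    _ = _ := Real.mul_self_sqrt (norm_nonneg _)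

theorem norm_le_norm_adj (T : AdjointableOp 𝔄 H K) : ‖T‖ ≤ ‖T.adj‖ := by
  rcases (norm_nonneg T).eq_or_lt with h | h
  · rw [← h]
    exact norm_nonneg _
  · exact le_of_mul_le_mul_right
      ((norm_sq_le_norm_adj_comp_self T).trans (norm_comp_le _ _)) h

theorem norm_adj (T : AdjointableOp 𝔄 H K) : ‖T.adj‖ = ‖T‖ :=
  le_antisymm (norm_le_norm_adj T.adj) (norm_le_norm_adj T)

instance instCStarRing : CStarRing (AdjointableOp 𝔄 H H) where
  norm_mul_self_le := norm_sq_le_norm_adj_comp_self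

instance instCompleteSpace [CompleteSpace H] [CompleteSpace K] :
    CompleteSpace (AdjointableOp 𝔄 H K) := by
  refine Metric.complete_of_cauchySeq_tendsto fun u hu => ?_
  have h1 : CauchySeq fun n => (u n).toCLM := by
    rw [Metric.cauchySeq_iff'] at hu ⊢
    intro ε hε
    obtain ⟨N, hN⟩ := hu ε hε
    refine ⟨N, fun n hn => ?_⟩
    have := hN n hn
    rw [dist_eq_norm, norm_def] at this
    rwa [dist_eq_norm]
  have h2 : CauchySeq fun n => (u n).adjCLM := by
    rw [Metric.cauchySeq_iff'] at hu ⊢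
    intro ε hε
    obtain ⟨N, hN⟩ := hu ε hε
    refine ⟨N, fun n hn => ?_⟩
    have := hN n hn
    rw [dist_eq_norm, ← norm_adj, norm_def] at this
    rwa [dist_eq_norm]
  obtain ⟨S, hS⟩ := cauchySeq_tendsto_of_complete h1
  obtain ⟨S', hS'⟩ := cauchySeq_tendsto_of_complete h2
  have hx (x : H) : Tendsto (fun n => (u n).toCLM x) atTop (𝓝 (S x)) :=
    ((ContinuousLinearMap.apply ℂ K x).continuous.tendsto S).comp hS
  have hy (y : K) : Tendsto (fun n => (u n).adjCLM y) atTop (𝓝 (S' y)) :=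
    ((ContinuousLinearMap.apply ℂ H y).continuous.tendsto S').comp hS'
  refine ⟨⟨S, S', fun x y => ?_⟩, ?_⟩
  · have e1 : Tendsto (fun n => inner 𝔄 ((u n).toCLM x) y) atTop (𝓝 (inner 𝔄 (S x) y)) :=
      ((CStarModule.continuous_inner (A := 𝔄) (E := K)).tendsto (S x, y)).comp
        ((hx x).prodMk_nhds tendsto_const_nhds)
    have e2 : Tendsto (fun n => inner 𝔄 x ((u n).adjCLM y)) atTop (𝓝 (inner 𝔄 x (S' y))) :=
      ((CStarModule.continuous_inner (A := 𝔄) (E := H)).tendsto (x, S' y)).comp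
        (tendsto_const_nhds.prodMk_nhds (hy y))
    refine tendsto_nhds_unique e1 ?_
    simpa only [(u _).inner_apply_left] using e2
  · rw [tendsto_iff_norm_sub_tendsto_zero] at hS ⊢
    exact hS

instance instCStarAlgebra [CompleteSpace H] : CStarAlgebra (AdjointableOp 𝔄 H H) where

instance instPartialOrder [CompleteSpace H] : PartialOrder (AdjointableOp 𝔄 H H) :=
  CStarAlgebra.spectralOrder _

instance instStarOrderedRing [CompleteSpace H] : StarOrderedRing (AdjointableOp 𝔄 H H) :=
  CStarAlgebra.spectralOrderedRing _

end CStar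

section Basic

variable {𝔄 H K E : Type*} [NonUnitalCStarAlgebra 𝔄] [PartialOrder 𝔄]
  [NormedAddCommGroup H] [NormedSpace ℂ H] [SMul 𝔄 H] [CStarModule 𝔄 H]
  [NormedAddCommGroup K] [NormedSpace ℂ K] [SMul 𝔄 K] [CStarModule 𝔄 K]
  [NormedAddCommGroup E] [NormedSpace ℂ E] [SMul 𝔄 E] [CStarModule 𝔄 E]

theorem isUnit_iff_isInvertible {T : AdjointableOp 𝔄 H H} : IsUnit T ↔ T.IsInvertible := by
  rw [isUnit_iff_exists]
  exact exists_congr fun S => and_comm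

theorem apply_eq_zero_of_add_eq_zero [StarOrderedRing 𝔄] {S : AdjointableOp 𝔄 H K} {T : AdjointableOp 𝔄 H E}
    {x : H} (h : (S.adj ∘ₐ S + T.adj ∘ₐ T) x = 0) : S x = 0 ∧ T x = 0 := by
  have h1 : inner 𝔄 (S x) (S x) + inner 𝔄 (T x) (T x) = 0 := by
    rw [S.inner_apply_left, T.inner_apply_left, ← CStarModule.inner_add_right]
    exact (congrArg (inner 𝔄 x) h).trans CStarModule.inner_zero_right
  have h2 := (add_eq_zero_iff_of_nonneg CStarModule.inner_self_nonneg
    CStarModule.inner_self_nonneg).mp h1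
  exact ⟨CStarModule.inner_self.mp h2.1, CStarModule.inner_self.mp h2.2⟩

end Basic

section Order

variable {𝔄 H K E : Type*} [NonUnitalCStarAlgebra 𝔄] [PartialOrder 𝔄] [StarOrderedRing 𝔄]
  [NormedAddCommGroup H] [NormedSpace ℂ H] [SMul 𝔄 H] [CStarModule 𝔄 H] [CompleteSpace H]
  [NormedAddCommGroup K] [NormedSpace ℂ K] [SMul 𝔄 K] [CStarModule 𝔄 K]
  [NormedAddCommGroup E] [NormedSpace ℂ E] [SMul 𝔄 E] [CStarModule 𝔄 E]

theorem nonneg_adj_comp_self (R : AdjointableOp 𝔄 H K) : 0 ≤ R.adj ∘ₐ R := by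
  set d := R.adj ∘ₐ R
  have hds : IsSelfAdjoint d := rfl
  set n := d⁻
  have hn0 : 0 ≤ n := CFC.negPart_nonneg d
  have hns : star n = n := hn0.isSelfAdjoint
  obtain ⟨s, hs⟩ := CStarAlgebra.nonneg_iff_eq_star_mul_self.mp hn0
  have hdn : n * d * n = -(star (s * n) * (s * n)) := by
    have h1 : d = d⁺ - n := (CFC.posPart_sub_negPart d hds).symm
    have h2 : d⁺ * n = 0 := CFC.posPart_mul_negPart d
    calc n * d * n = n * (d⁺ - n) * n := by rw [← h1]
      _ = n * (d⁺ * n) - n * n * n := by noncomm_ring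
      _ = -(n * (star s * s) * n) := by rw [h2, ← hs]; simp
      _ = _ := by rw [star_mul, hns]; noncomm_ring
  have hsum : (R ∘ₐ n).adj ∘ₐ (R ∘ₐ n) + (s * n).adj ∘ₐ (s * n) = 0 := by
    have : (R ∘ₐ n).adj ∘ₐ (R ∘ₐ n) = n * d * n := by
      rw [adj_comp, ← star_eq_adj n, hns]
      rfl
    rw [this, hdn]
    exact neg_add_cancel _
  have hsn : s * n = 0 := ext_of_apply fun x =>
    (apply_eq_zero_of_add_eq_zero (congrArg (fun T : AdjointableOp 𝔄 H H => T x) hsum)).2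
  have hnn : star n * n = 0 := by rw [hns]; nth_rw 1 [hs]; rw [mul_assoc, hsn, mul_zero]
  have hn_zero : n = 0 := CStarRing.star_mul_self_eq_zero_iff n |>.mp hnn
  exact (CFC.negPart_eq_zero_iff d hds).mp hn_zero

theorem IsPos.nonneg {T : AdjointableOp 𝔄 H H} (hT : T.IsPos) : 0 ≤ T := by
  obtain ⟨S, rfl⟩ := hT
  exact nonneg_adj_comp_self S

theorem isPosDef_iff {T : AdjointableOp 𝔄 H H} : T.IsPosDef ↔ IsStrictlyPositive T := by
  constructor
  · rintro ⟨⟨-, h1⟩, h2⟩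
    exact ⟨h2.nonneg, isUnit_iff_isInvertible.mpr h1⟩
  · intro h
    exact ⟨⟨h.isSelfAdjoint, isUnit_iff_isInvertible.mp h.isUnit⟩,
      CStarAlgebra.nonneg_iff_eq_star_mul_self.mp h.nonneg⟩

theorem conj_nonneg [CompleteSpace K] {V : AdjointableOp 𝔄 K K} (hV : 0 ≤ V)
    (T : AdjointableOp 𝔄 H K) : 0 ≤ T.adj ∘ₐ V ∘ₐ T := by
  obtain ⟨S, rfl⟩ := CStarAlgebra.nonneg_iff_eq_star_mul_self.mp hV
  exact nonneg_adj_comp_self (S ∘ₐ T)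

theorem smul_gram_le_conj [CompleteSpace K] {V : AdjointableOp 𝔄 K K} {c : ℝ}
    (hV : c • (1 : AdjointableOp 𝔄 K K) ≤ V) (T : AdjointableOp 𝔄 H K) :
    c • (T.adj ∘ₐ T) ≤ T.adj ∘ₐ V ∘ₐ T := by
  rw [← sub_nonneg]
  have h := conj_nonneg (sub_nonneg.mpr hV) T
  rw [sub_comp, comp_sub] at h
  have e : T.adj ∘ₐ (c • (1 : AdjointableOp 𝔄 K K)) ∘ₐ T = c • (T.adj ∘ₐ T) := by
    rw [← Complex.coe_smul, ← Complex.coe_smul, smul_comp, comp_smul]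
    rfl
  rwa [e] at h

end Order

end AdjointableOp

section CStarAlgebra

variable {R : Type*} [CStarAlgebra R] [PartialOrder R] [StarOrderedRing R]

theorem IsStrictlyPositive.exists_smul_one_le {a : R} (ha : IsStrictlyPositive a) :
    ∃ c : ℝ, 0 < c ∧ c • (1 : R) ≤ a := by
  cases subsingleton_or_nontrivial R
  · exact ⟨1, one_pos, (Subsingleton.elim _ _).le⟩
  · obtain ⟨c, hc, h⟩ := (CFC.exists_pos_algebraMap_le_iff (a := a) ha.isSelfAdjoint).mpr
      fun x hx => ha.spectrum_pos hx
    exact ⟨c, hc, by rwa [← Algebra.algebraMap_eq_smul_one]⟩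

theorem IsStrictlyPositive.of_smul_one_le {a : R} {c : ℝ} (hc : 0 < c) (h : c • (1 : R) ≤ a) :
    IsStrictlyPositive a :=
  (IsStrictlyPositive.smul hc isStrictlyPositive_one).of_le h

theorem norm_le_inv_of_smul_one_le {a r : R} {c : ℝ} (hc : 0 < c) (h : c • (1 : R) ≤ a)
    (hr : IsSelfAdjoint r) (har : a * r = 1) : ‖r‖ ≤ c⁻¹ := by
  have h1 : c • (r * r) ≤ r := by
    have := star_left_conjugate_le_conjugate h r
    rwa [hr.star_eq, mul_assoc r a r, har, mul_smul_comm, smul_mul_assoc, mul_one] at this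
  have h0 : 0 ≤ c • (r * r) := by
    refine smul_nonneg hc.le ?_
    have := star_mul_self_nonneg r
    rwa [hr.star_eq] at this
  have h2 := CStarAlgebra.norm_le_norm_of_nonneg_of_le h0 h1
  rw [norm_smul, Real.norm_of_nonneg hc.le] at h2
  have h3 : ‖r * r‖ = ‖r‖ * ‖r‖ := by
    have := CStarRing.norm_star_mul_self (x := r)
    rwa [hr.star_eq] at this
  rw [h3] at h2
  rcases (norm_nonneg r).eq_or_lt with h | h
  · rw [← h]
    positivity
  · rw [le_inv_comm₀ h hc, ← one_div, le_div_iff₀ h]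
    nlinarith

end CStarAlgebra

end

noncomputable section

theorem IsStrictlyPositive.add_of_smul_le {R : Type*} [CStarAlgebra R] [PartialOrder R]
    [StarOrderedRing R] {x y f : R} {c : ℝ} (hx : IsStrictlyPositive (x + f)) (hx0 : 0 ≤ x)
    (hf : 0 ≤ f) (hc : 0 < c) (h : c • x ≤ y) : IsStrictlyPositive (y + f) := by
  refine (hx.smul (lt_min hc one_pos)).of_le ?_
  rw [smul_add]
  refine add_le_add ((smul_le_smul_of_nonneg_right (min_le_left c 1) hx0).trans h) ?_
  simpa using smul_le_smul_of_nonneg_right (min_le_right c 1) hf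

theorem IsSelfAdjoint.of_mul_eq_one {R : Type*} [Ring R] [StarRing R] {a r : R}
    (ha : IsSelfAdjoint a) (h : a * r = 1) : IsSelfAdjoint r := by
  have h1 : star r * a = 1 := by rw [← star_one, ← h, star_mul, ha.star_eq]
  exact left_inv_eq_right_inv h1 h

namespace AdjointableOp

section MP

variable {𝔄 H K : Type*} [NonUnitalCStarAlgebra 𝔄] [PartialOrder 𝔄]
  [NormedAddCommGroup H] [NormedSpace ℂ H] [SMul 𝔄 H] [CStarModule 𝔄 H]
  [NormedAddCommGroup K] [NormedSpace ℂ K] [SMul 𝔄 K] [CStarModule 𝔄 K]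
  {A : AdjointableOp 𝔄 H K} {Z : AdjointableOp 𝔄 K H}

theorem IsWMPInverse.initial_selfAdj (hZ : IsWMPInverse (one 𝔄 K) (one 𝔄 H) A Z) :
    star (Z ∘ₐ A) = Z ∘ₐ A := hZ.right_selfAdj

theorem IsWMPInverse.initial_mul_self (hZ : IsWMPInverse (one 𝔄 K) (one 𝔄 H) A Z) :
    (Z ∘ₐ A) * (Z ∘ₐ A) = Z ∘ₐ A :=
  congrArg (Z ∘ₐ ·) hZ.mul_mul_left

theorem IsWMPInverse.kernelProj_selfAdj (hZ : IsWMPInverse (one 𝔄 K) (one 𝔄 H) A Z) :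
    star (1 - Z ∘ₐ A) = 1 - Z ∘ₐ A := by
  rw [star_sub, star_one, hZ.initial_selfAdj]

theorem IsWMPInverse.kernelProj_mul_self (hZ : IsWMPInverse (one 𝔄 K) (one 𝔄 H) A Z) :
    (1 - Z ∘ₐ A) * (1 - Z ∘ₐ A) = 1 - Z ∘ₐ A :=
  IsIdempotentElem.one_sub hZ.initial_mul_self

theorem IsWMPInverse.comp_kernelProj (hZ : IsWMPInverse (one 𝔄 K) (one 𝔄 H) A Z) :
    A ∘ₐ (1 - Z ∘ₐ A) = 0 := by
  rw [comp_sub, hZ.mul_mul_left]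
  exact sub_self A

end MP

section Exist

variable {𝔄 H K E : Type*} [NonUnitalCStarAlgebra 𝔄] [PartialOrder 𝔄] [StarOrderedRing 𝔄]
  [NormedAddCommGroup H] [NormedSpace ℂ H] [SMul 𝔄 H] [CStarModule 𝔄 H] [CompleteSpace H]
  [NormedAddCommGroup K] [NormedSpace ℂ K] [SMul 𝔄 K] [CStarModule 𝔄 K]
  {A : AdjointableOp 𝔄 H K} {Z : AdjointableOp 𝔄 K H}

theorem nonneg_of_selfAdj_idem {F : AdjointableOp 𝔄 H H} (h1 : star F = F) (h2 : F * F = F) :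
    0 ≤ F := by
  have := star_mul_self_nonneg F
  rwa [h1, h2] at this

/-- Adding the projection onto the null space to `A⋆ A` yields a positive definite operator. -/
theorem IsWMPInverse.gram_add_kernelProj (hZ : IsWMPInverse (one 𝔄 K) (one 𝔄 H) A Z) :
    IsStrictlyPositive (A.adj ∘ₐ A + (1 - Z ∘ₐ A)) := by
  set F := 1 - Z ∘ₐ A with hF
  have hF1 : star F = F := hZ.kernelProj_selfAdj
  have hF2 : F * F = F := hZ.kernelProj_mul_self
  have hAF : A ∘ₐ F = 0 := hZ.comp_kernelProj
  have hFZ : F ∘ₐ Z = 0 := by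
    rw [hF, sub_comp, comp_assoc, hZ.mul_mul_right]
    exact sub_self Z
  have hAZ : A.adj ∘ₐ A ∘ₐ Z = A.adj := by
    have h : (A ∘ₐ Z).adj = A ∘ₐ Z := hZ.left_selfAdj
    rw [← h]
    exact congrArg adj hZ.mul_mul_left
  have h0 : 0 ≤ A.adj ∘ₐ A + F :=
    add_nonneg (nonneg_adj_comp_self A) (nonneg_of_selfAdj_idem hF1 hF2)
  have hr : (A.adj ∘ₐ A + F) * (Z ∘ₐ Z.adj + F) = 1 := by
    have e1 : (A.adj ∘ₐ A) * (Z ∘ₐ Z.adj) = Z ∘ₐ A :=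
      (congrArg (· ∘ₐ Z.adj) hAZ).trans hZ.right_selfAdj
    have e2 : (A.adj ∘ₐ A) * F = 0 := (congrArg (A.adj ∘ₐ ·) hAF).trans (comp_zero _)
    have e3 : F * (Z ∘ₐ Z.adj) = 0 := congrArg (· ∘ₐ Z.adj) hFZ |>.trans (zero_comp _)
    rw [add_mul, mul_add, mul_add, e1, e2, e3, hF2, hF]
    abel
  have hl : (Z ∘ₐ Z.adj + F) * (A.adj ∘ₐ A + F) = 1 := by
    have := congrArg star hr
    rwa [star_mul, star_add, star_add, hF1, star_one] at this
  exact ⟨h0, isUnit_iff_exists.mpr ⟨_, hr, hl⟩⟩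

variable [CompleteSpace K]

/-- A Moore-Penrose invertible operator has a weighted Moore-Penrose inverse for all positive
definite weights. -/
theorem IsWMPInverse.wmpInvertible (hZ : IsWMPInverse (one 𝔄 K) (one 𝔄 H) A Z)
    {V : AdjointableOp 𝔄 K K} {U : AdjointableOp 𝔄 H H} (hV : IsStrictlyPositive V)
    (hU : IsStrictlyPositive U) : WMPInvertible V U A := by
  have hVs : V.adj = V := hV.isSelfAdjoint
  have hUs : star U = U := hU.isSelfAdjoint
  set F := 1 - Z ∘ₐ A with hF
  have hF1 : star F = F := hZ.kernelProj_selfAdj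
  have hF2 : F * F = F := hZ.kernelProj_mul_self
  have hAF : A ∘ₐ F = 0 := hZ.comp_kernelProj
  have hF0 := nonneg_of_selfAdj_idem hF1 hF2
  have hp0 : 0 ≤ 1 - F := by
    rw [hF, sub_sub_cancel]
    exact nonneg_of_selfAdj_idem hZ.initial_selfAdj hZ.initial_mul_self
  set a := A.adj ∘ₐ V ∘ₐ A
  obtain ⟨c, hc, hcV⟩ := hV.exists_smul_one_le
  obtain ⟨d, hd, hdU⟩ := hU.exists_smul_one_le
  have hS1 : IsStrictlyPositive (a + F) :=
    hZ.gram_add_kernelProj.add_of_smul_le (nonneg_adj_comp_self A) hF0 hc (smul_gram_le_conj hcV A)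
  have hS2 : IsStrictlyPositive (F * U * F + (1 - F)) := by
    refine IsStrictlyPositive.add_of_smul_le (x := F) (c := d) ?_ hF0 hp0 hd ?_
    · rw [add_sub_cancel]
      exact isStrictlyPositive_one
    · have h := star_left_conjugate_le_conjugate hdU F
      rwa [hF1, mul_smul_comm, smul_mul_assoc, mul_one, hF2] at h
  obtain ⟨r, hr1, hr2⟩ := isUnit_iff_exists.mp hS1.isUnit
  obtain ⟨s, hs1, hs2⟩ := isUnit_iff_exists.mp hS2.isUnit
  have hrs : star r = r := hS1.isSelfAdjoint.of_mul_eq_one hr1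
  have hss : star s = s := hS2.isSelfAdjoint.of_mul_eq_one hs1
  have haF : a * F = 0 := by
    change (A.adj ∘ₐ V) ∘ₐ (A ∘ₐ F) = 0
    rw [hAF, comp_zero]
  have hrF : r * F = F := by
    calc r * F = r * ((a + F) * F) := by rw [add_mul, haF, hF2, zero_add]
      _ = F := by rw [← mul_assoc, hr2, one_mul]
  have hra : r * a = 1 - F := by
    rw [← hr2, mul_add, hrF, add_sub_cancel_right]
  have hsF' : s * (1 - F) = 1 - F := by
    calc s * (1 - F) = s * ((F * U * F + (1 - F)) * (1 - F)) := by
          have h1 : F * (1 - F) = 0 := by rw [mul_sub, hF2, mul_one, sub_self]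
          rw [add_mul, mul_assoc (F * U), h1, mul_zero, zero_add, IsIdempotentElem.one_sub hF2]
      _ = 1 - F := by rw [← mul_assoc, hs2, one_mul]
  have hsF : F * s = s * F := by
    have h := congrArg star hsF'
    rw [star_mul, star_sub, star_one, hF1, hss] at h
    replace h := h.trans hsF'.symm
    rw [mul_sub, sub_mul, mul_one, one_mul] at h
    exact sub_right_inj.mp h
  set e := s * F * U with he
  have heF : e * F = F := by
    have h : s * (F * U * F) + s * (1 - F) = 1 := by rw [← mul_add, hs2]
    rw [hsF'] at h
    calc e * F = s * (F * U * F) := by rw [he]; simp only [mul_assoc]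
      _ = F := by rw [eq_sub_of_add_eq h, sub_sub_cancel]
  have hFe : F * e = e := by
    rw [he, ← mul_assoc, ← mul_assoc, hsF, mul_assoc s, hF2]
  have hee : e * e = e := by
    nth_rw 2 [← hFe]
    rw [← mul_assoc, heF, hFe]
  have hUe : star (U * e) = U * e := by
    rw [he, star_mul, star_mul, star_mul, hUs, hF1, hss, hsF]
    simp only [mul_assoc]
  have hAe : A ∘ₐ e = 0 := by
    rw [← hFe]
    exact (congrArg (· ∘ₐ e) hAF).trans (zero_comp _)
  set X₁ := r ∘ₐ A.adj ∘ₐ V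
  have hX₁A : X₁ ∘ₐ A = 1 - F := hra
  have hAX : A ∘ₐ (1 - e) ∘ₐ X₁ = A ∘ₐ X₁ := by
    change (A ∘ₐ (1 - e)) ∘ₐ X₁ = A ∘ₐ X₁
    rw [comp_sub, hAe, sub_zero]
    rfl
  have hXA : ((1 - e) ∘ₐ X₁) ∘ₐ A = 1 - e := by
    rw [comp_assoc, hX₁A, ← mul_eq_comp, mul_sub, sub_mul _ _ F, heF]
    simp
  refine ⟨(1 - e) ∘ₐ X₁, ?_, ?_, ?_, ?_⟩
  · rw [hXA, comp_sub, hAe, sub_zero]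
    rfl
  · change ((1 - e) ∘ₐ X₁) ∘ₐ A ∘ₐ (1 - e) ∘ₐ X₁ = _
    rw [← comp_assoc, hXA]
    change ((1 - e) * (1 - e)) ∘ₐ X₁ = _
    rw [IsIdempotentElem.one_sub hee]
  · rw [hAX]
    change V.adj ∘ₐ A ∘ₐ r.adj ∘ₐ A.adj ∘ₐ V.adj = _
    rw [hVs, ← star_eq_adj r, hrs]
  · rw [hXA]
    change star (U * (1 - e)) = U * (1 - e)
    rw [mul_sub, mul_one, star_sub, hUe, hUs]

end Exist

section Embedding

variable {𝔄 H K : Type*} [NonUnitalCStarAlgebra 𝔄] [PartialOrder 𝔄]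
  [NormedAddCommGroup H] [NormedSpace ℂ H] [SMul 𝔄 H] [CStarModule 𝔄 H]
  [NormedAddCommGroup K] [NormedSpace ℂ K] [SMul 𝔄 K] [CStarModule 𝔄 K]

/-- The inclusion of a complemented submodule; its adjoint is the projection. -/
def IsProjOnto.incl {P : AdjointableOp 𝔄 H H} {S : AlgSubmodule 𝔄 H} (hP : P.IsProjOnto S) :
    AdjointableOp 𝔄 S.toSubmodule H where
  toCLM := S.toSubmodule.subtypeL
  adjCLM := P.toCLM.codRestrict S.toSubmodule hP.apply_mem
  inner_apply_left x y := by
    have h1 : P (x : H) = x := hP.apply_of_mem x x.2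
    have h2 : P.adj = P := hP.selfAdj
    change inner 𝔄 (x : H) y = inner 𝔄 (x : H) (P y)
    nth_rw 1 [← h1]
    rw [P.inner_apply_left]
    exact congrArg (fun T : AdjointableOp 𝔄 H H => inner 𝔄 (x : H) (T y)) h2

variable {P Q : AdjointableOp 𝔄 H H} {S S' : AlgSubmodule 𝔄 H}

theorem IsProjOnto.incl_comp_adj (hP : P.IsProjOnto S) : hP.incl ∘ₐ hP.incl.adj = P :=
  ext_of_apply fun _ => rfl

theorem IsProjOnto.adj_comp_incl (hP : P.IsProjOnto S) :
    hP.incl.adj ∘ₐ hP.incl = one 𝔄 S.toSubmodule :=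
  ext_of_apply fun x => Subtype.ext (hP.apply_of_mem x x.2)

theorem IsProjOnto.comp_incl (hP : P.IsProjOnto S) : P ∘ₐ hP.incl = hP.incl :=
  ext_of_apply fun x => hP.apply_of_mem x x.2

theorem IsProjOnto.adj_comp_incl_eq_zero (hP : P.IsProjOnto S) (hQ : Q.IsProjOnto S')
    (h : P * Q = 0) : hP.incl.adj ∘ₐ hQ.incl = 0 := by
  calc hP.incl.adj ∘ₐ hQ.incl = (P ∘ₐ hP.incl).adj ∘ₐ (Q ∘ₐ hQ.incl) := by
        rw [hP.comp_incl, hQ.comp_incl]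
    _ = hP.incl.adj ∘ₐ (P.adj ∘ₐ Q) ∘ₐ hQ.incl := rfl
    _ = hP.incl.adj ∘ₐ (P * Q) ∘ₐ hQ.incl := by rw [show P.adj = P from hP.selfAdj]; rfl
    _ = 0 := by rw [h, zero_comp, comp_zero]

/-- Extension of an operator on a complemented submodule by zero. -/
def IsProjOnto.extend (hP : P.IsProjOnto S)
    (T : AdjointableOp 𝔄 S.toSubmodule S.toSubmodule) : AdjointableOp 𝔄 H H :=
  hP.incl ∘ₐ T ∘ₐ hP.incl.adj

theorem IsProjOnto.extend_mul_extend (hP : P.IsProjOnto S)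
    (T T' : AdjointableOp 𝔄 S.toSubmodule S.toSubmodule) :
    hP.extend T * hP.extend T' = hP.extend (T * T') := by
  change hP.incl ∘ₐ T ∘ₐ (hP.incl.adj ∘ₐ hP.incl) ∘ₐ T' ∘ₐ hP.incl.adj = _
  rw [hP.adj_comp_incl]
  rfl

theorem IsProjOnto.extend_mul_extend_eq_zero (hP : P.IsProjOnto S) (hQ : Q.IsProjOnto S')
    (h : P * Q = 0) (T : AdjointableOp 𝔄 S.toSubmodule S.toSubmodule)
    (T' : AdjointableOp 𝔄 S'.toSubmodule S'.toSubmodule) :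
    hP.extend T * hQ.extend T' = 0 := by
  change hP.incl ∘ₐ T ∘ₐ (hP.incl.adj ∘ₐ hQ.incl) ∘ₐ T' ∘ₐ hQ.incl.adj = _
  rw [hP.adj_comp_incl_eq_zero hQ h, zero_comp, comp_zero, comp_zero]

theorem IsProjOnto.extend_one (hP : P.IsProjOnto S) : hP.extend 1 = P := hP.incl_comp_adj

theorem IsProjOnto.extend_nonneg [StarOrderedRing 𝔄] [CompleteSpace H] (hP : P.IsProjOnto S)
    {T : AdjointableOp 𝔄 S.toSubmodule S.toSubmodule} (hT : T.IsPos) : 0 ≤ hP.extend T := by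
  obtain ⟨R, rfl⟩ := hT
  exact nonneg_adj_comp_self (R ∘ₐ hP.incl.adj)

/-- The orthogonal sum of two positive definite operators is positive definite. -/
theorem IsProjOnto.isStrictlyPositive_extend_add_extend [StarOrderedRing 𝔄] [CompleteSpace H]
    (hP : P.IsProjOnto S) (hQ : Q.IsProjOnto S') (h : P + Q = 1)
    {T : AdjointableOp 𝔄 S.toSubmodule S.toSubmodule} (hT : T.IsPosDef)
    {T' : AdjointableOp 𝔄 S'.toSubmodule S'.toSubmodule} (hT' : T'.IsPosDef) :
    IsStrictlyPositive (hP.extend T + hQ.extend T') := by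
  have hQ2 : Q * Q = Q := hQ.idem
  have hPQ : P * Q = 0 := by rw [eq_sub_of_add_eq h, sub_mul, one_mul, hQ2, sub_self]
  have hQP : Q * P = 0 := by rw [eq_sub_of_add_eq h, mul_sub, mul_one, hQ2, sub_self]
  obtain ⟨R, hR1, hR2⟩ := hT.1.2
  obtain ⟨R', hR1', hR2'⟩ := hT'.1.2
  refine ⟨add_nonneg (hP.extend_nonneg hT.2) (hQ.extend_nonneg hT'.2),
    isUnit_iff_exists.mpr ⟨hP.extend R + hQ.extend R', ?_, ?_⟩⟩
  · rw [add_mul, mul_add, mul_add, hP.extend_mul_extend, hQ.extend_mul_extend,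
      hP.extend_mul_extend_eq_zero hQ hPQ, hQ.extend_mul_extend_eq_zero hP hQP,
      mul_eq_comp T, mul_eq_comp T', hR2, hR2', ← one_eq, ← one_eq, hP.extend_one, hQ.extend_one,
      add_zero, zero_add, h]
  · rw [add_mul, mul_add, mul_add, hP.extend_mul_extend, hQ.extend_mul_extend,
      hP.extend_mul_extend_eq_zero hQ hPQ, hQ.extend_mul_extend_eq_zero hP hQP,
      mul_eq_comp R, mul_eq_comp R', hR1, hR1', ← one_eq, ← one_eq, hP.extend_one, hQ.extend_one,
      add_zero, zero_add, h]

theorem isWMPInverse_sub_of_add {D R : AdjointableOp 𝔄 H H} (hD : star D = D) (hP : star P = P)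
    (hP2 : P * P = P) (hDP : D * P = 0) (h1 : (D + P) * R = 1) (h2 : R * (D + P) = 1) :
    IsWMPInverse (one 𝔄 H) (one 𝔄 H) D (R - P) := by
  have hPD : P * D = 0 := by
    have := congrArg star hDP
    rwa [star_mul, hP, hD, star_zero] at this
  have hRP : R * P = P := by
    calc R * P = R * ((D + P) * P) := by rw [add_mul, hDP, zero_add, hP2]
      _ = P := by rw [← mul_assoc, h2, one_mul]
  have hPR : P * R = P := by
    calc P * R = P * (D + P) * R := by rw [mul_add, hPD, zero_add, hP2]
      _ = P := by rw [mul_assoc, h1, mul_one]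
  have e1 : D * (R - P) = 1 - P := by
    rw [mul_sub, hDP, sub_zero, ← h1, add_mul, hPR, add_sub_cancel_right]
  have e2 : (R - P) * D = 1 - P := by
    rw [sub_mul, hPD, sub_zero, ← h2, mul_add, hRP, add_sub_cancel_right]
  refine ⟨?_, ?_, ?_, ?_⟩
  · change D * ((R - P) * D) = D
    rw [e2, mul_sub, mul_one, hDP, sub_zero]
  · change (R - P) * (D * (R - P)) = R - P
    rw [e1, mul_sub, mul_one, sub_mul, hRP, hP2, sub_self, sub_zero]
  · change star (1 * (D * (R - P))) = 1 * (D * (R - P))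
    rw [e1, one_mul, star_sub, star_one, hP]
  · change star (1 * ((R - P) * D)) = 1 * ((R - P) * D)
    rw [e2, one_mul, star_sub, star_one, hP]

theorem isWeight_one : (one 𝔄 H).IsWeight := ⟨rfl, one 𝔄 H, rfl, rfl⟩

theorem IsWMPInverse.wmpInv_eq {M : AdjointableOp 𝔄 K K} {N : AdjointableOp 𝔄 H H}
    {A : AdjointableOp 𝔄 H K} {X : AdjointableOp 𝔄 K H} (hM : M.IsWeight) (hN : N.IsWeight)
    (hX : IsWMPInverse M N A X) : wmpInv M N A = X := by
  have h : WMPInvertible M N A := ⟨X, hX⟩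
  rw [wmpInv, dif_pos h]
  exact h.choose_spec.unique hM hN hX

end Embedding

section SelfAdjointMP

variable {𝔄 H : Type*} [NonUnitalCStarAlgebra 𝔄] [PartialOrder 𝔄]
  [NormedAddCommGroup H] [NormedSpace ℂ H] [SMul 𝔄 H] [CStarModule 𝔄 H]
  {T Z : AdjointableOp 𝔄 H H}

theorem IsWMPInverse.mul_comm_of_selfAdj (hZ : IsWMPInverse (one 𝔄 H) (one 𝔄 H) T Z)
    (hT : star T = T) : T * Z = Z * T := by
  have e1 : T * Z * T = T := hZ.mul_mul_left
  have h1 : star (T * Z) = T * Z := hZ.left_selfAdj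
  have h2 : star (Z * T) = Z * T := hZ.right_selfAdj
  have e2 : T * (T * Z) = T := by
    have := congrArg star e1
    rwa [star_mul, h1, hT] at this
  have e3 : Z * T * T = T := by
    have := congrArg star e1
    rwa [mul_assoc, star_mul, h2, hT] at this
  calc T * Z = Z * T * T * Z := by rw [e3]
    _ = Z * (T * (T * Z)) := by simp only [mul_assoc]
    _ = Z * T := by rw [e2]

theorem IsWMPInverse.isProjOnto_range (hZ : IsWMPInverse (one 𝔄 H) (one 𝔄 H) T Z) :
    (T ∘ₐ Z).IsProjOnto T.range where
  idem := congrArg (fun R : AdjointableOp 𝔄 H H => R ∘ₐ Z) hZ.mul_mul_left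
  selfAdj := hZ.left_selfAdj
  apply_mem x := ⟨Z x, rfl⟩
  apply_of_mem := by
    rintro _ ⟨y, rfl⟩
    exact congrArg (fun R : AdjointableOp 𝔄 H H => R y) hZ.mul_mul_left

variable [StarOrderedRing 𝔄] [CompleteSpace H]

theorem IsWMPInverse.isStrictlyPositive_add_kernelProj
    (hZ : IsWMPInverse (one 𝔄 H) (one 𝔄 H) T Z) (hT : 0 ≤ T) :
    IsStrictlyPositive (T + (1 - Z ∘ₐ T)) := by
  set F := 1 - Z ∘ₐ T with hF
  have hTs : star T = T := hT.isSelfAdjoint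
  have hF1 : star F = F := hZ.kernelProj_selfAdj
  have hF2 : F * F = F := hZ.kernelProj_mul_self
  have hTF : T * F = 0 := hZ.comp_kernelProj
  have hFT : F * T = 0 := by
    have := congrArg star hTF
    rwa [star_mul, hF1, hTs, star_zero] at this
  refine ⟨add_nonneg hT (nonneg_of_selfAdj_idem hF1 hF2), ?_⟩
  have h : IsUnit ((T + F) ^ 2) := by
    have e : (T + F) ^ 2 = T.adj ∘ₐ T + F := by
      rw [← star_eq_adj, hTs, ← mul_eq_comp, sq, add_mul, mul_add, mul_add, hTF, hFT, hF2,
        add_zero, zero_add]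
    rw [e]
    exact hZ.gram_add_kernelProj.isUnit
  exact (isUnit_pow_iff two_ne_zero).mp h

end SelfAdjointMP

section Weighted

variable {𝔄 H K : Type*} [NonUnitalCStarAlgebra 𝔄] [PartialOrder 𝔄]
  [NormedAddCommGroup H] [NormedSpace ℂ H] [SMul 𝔄 H] [CStarModule 𝔄 H]
  [NormedAddCommGroup K] [NormedSpace ℂ K] [SMul 𝔄 K] [CStarModule 𝔄 K]

theorem IsWMPInverse.adj_comp_eq {A : AdjointableOp 𝔄 H K} {V : AdjointableOp 𝔄 K K}
    {U : AdjointableOp 𝔄 H H} {X : AdjointableOp 𝔄 K H} (hX : IsWMPInverse V U A X)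
    (hV : V.IsSelfAdj) : A.adj ∘ₐ V ∘ₐ A ∘ₐ X = A.adj ∘ₐ V := by
  have h1 : X.adj ∘ₐ A.adj ∘ₐ V.adj = V ∘ₐ A ∘ₐ X := hX.left_selfAdj
  have h2 : A.adj ∘ₐ X.adj ∘ₐ A.adj = A.adj := congrArg adj hX.mul_mul_left
  rw [← h1, show V.adj = V from hV]
  exact congrArg (· ∘ₐ V) h2

theorem IsWMPInverse.weight_comp_eq {A : AdjointableOp 𝔄 H K} {V : AdjointableOp 𝔄 K K}
    {U : AdjointableOp 𝔄 H H} {X : AdjointableOp 𝔄 K H} (hX : IsWMPInverse V U A X)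
    (hU : U.IsSelfAdj) : A.adj ∘ₐ X.adj ∘ₐ U ∘ₐ X = U ∘ₐ X := by
  have h1 : A.adj ∘ₐ X.adj ∘ₐ U.adj = U ∘ₐ X ∘ₐ A := hX.right_selfAdj
  rw [show U.adj = U from hU] at h1
  calc A.adj ∘ₐ X.adj ∘ₐ U ∘ₐ X = (A.adj ∘ₐ X.adj ∘ₐ U) ∘ₐ X := rfl
    _ = U ∘ₐ (X ∘ₐ A ∘ₐ X) := by rw [h1]; rfl
    _ = U ∘ₐ X := by rw [hX.mul_mul_right]

end Weighted

section Limit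

variable {𝔄 H K : Type*} [NonUnitalCStarAlgebra 𝔄] [PartialOrder 𝔄] [StarOrderedRing 𝔄]
  [NormedAddCommGroup H] [NormedSpace ℂ H] [SMul 𝔄 H] [CStarModule 𝔄 H] [CompleteSpace H]
  [NormedAddCommGroup K] [NormedSpace ℂ K] [SMul 𝔄 K] [CStarModule 𝔄 K]

/-- If `g` dominates both `m` and `A⋆ S⋆ S A`, then `g⁻¹ A⋆ S⋆` has norm at most `m ^ (-1 / 2)`. -/
theorem sq_norm_resolvent_le {A : AdjointableOp 𝔄 H K} {S : AdjointableOp 𝔄 K K}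
    {g R : AdjointableOp 𝔄 H H} {m : ℝ} (hm : 0 < m) (hmg : m • (1 : AdjointableOp 𝔄 H H) ≤ g)
    (hg : A.adj ∘ₐ (S.adj ∘ₐ S) ∘ₐ A ≤ g) (hR : g * R = 1) :
    ‖R ∘ₐ A.adj ∘ₐ S.adj‖ ^ 2 ≤ m⁻¹ := by
  have hgs : IsSelfAdjoint g := (IsStrictlyPositive.of_smul_one_le hm hmg).isSelfAdjoint
  have hRs : star R = R := hgs.of_mul_eq_one hR
  have hRs' : R.adj = R := hRs
  have h1 := star_left_conjugate_le_conjugate hg R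
  rw [hRs, mul_assoc R g R, hR, mul_one] at h1
  have h0 : 0 ≤ R * (A.adj ∘ₐ (S.adj ∘ₐ S) ∘ₐ A) * R := by
    have h := nonneg_adj_comp_self (S ∘ₐ A ∘ₐ R)
    change 0 ≤ R.adj * (A.adj ∘ₐ (S.adj ∘ₐ S) ∘ₐ A) * R at h
    rwa [hRs'] at h
  calc ‖R ∘ₐ A.adj ∘ₐ S.adj‖ ^ 2 = ‖S ∘ₐ A ∘ₐ R‖ * ‖S ∘ₐ A ∘ₐ R‖ := by
        rw [← norm_adj (S ∘ₐ A ∘ₐ R), sq]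
        change _ = ‖R.adj ∘ₐ A.adj ∘ₐ S.adj‖ * ‖R.adj ∘ₐ A.adj ∘ₐ S.adj‖
        rw [hRs']
    _ ≤ ‖(S ∘ₐ A ∘ₐ R).adj ∘ₐ S ∘ₐ A ∘ₐ R‖ := norm_sq_le_norm_adj_comp_self _
    _ = ‖R * (A.adj ∘ₐ (S.adj ∘ₐ S) ∘ₐ A) * R‖ := by
        change ‖R.adj ∘ₐ A.adj ∘ₐ S.adj ∘ₐ S ∘ₐ A ∘ₐ R‖ = _
        rw [hRs']
        rfl
    _ ≤ ‖R‖ := CStarAlgebra.norm_le_norm_of_nonneg_of_le h0 h1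
    _ ≤ m⁻¹ := norm_le_inv_of_smul_one_le hm hmg hRs hR

/-- The regularised solution operators converge with rate `t ^ (1 / 2)`. -/
theorem sq_norm_regularised_sub_le {A : AdjointableOp 𝔄 H K} {S V' C : AdjointableOp 𝔄 K K}
    {b P R : AdjointableOp 𝔄 H H} {X : AdjointableOp 𝔄 K H} {t m : ℝ}
    (hSV : (S.adj ∘ₐ S) ∘ₐ V' = one 𝔄 K)
    (hAX : A.adj ∘ₐ (S.adj ∘ₐ S) ∘ₐ A ∘ₐ X = A.adj ∘ₐ S.adj ∘ₐ S)
    (hbX : b ∘ₐ X = A.adj ∘ₐ C) (hPX : P ∘ₐ X = 0) (hPA : P ∘ₐ A.adj = 0)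
    (hb : 0 ≤ b) (hP : 0 ≤ P) (ht : 0 < t) (hm : 0 < m)
    (hlow : (t * m) • (1 : AdjointableOp 𝔄 H H) ≤
      A.adj ∘ₐ (S.adj ∘ₐ S) ∘ₐ A + (t : ℂ) • b + P)
    (hR1 : (A.adj ∘ₐ (S.adj ∘ₐ S) ∘ₐ A + (t : ℂ) • b + P) * R = 1)
    (hR2 : R * (A.adj ∘ₐ (S.adj ∘ₐ S) ∘ₐ A + (t : ℂ) • b + P) = 1) :
    ‖(R - P) ∘ₐ A.adj ∘ₐ S.adj ∘ₐ S - X‖ ^ 2 ≤ t * (m⁻¹ * ‖S ∘ₐ V' ∘ₐ C‖ ^ 2) := by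
  set a := A.adj ∘ₐ (S.adj ∘ₐ S) ∘ₐ A
  have hX : X = R ∘ₐ A.adj ∘ₐ S.adj ∘ₐ S + (t : ℂ) • (R ∘ₐ A.adj ∘ₐ C) := by
    calc X = (R * (a + (t : ℂ) • b + P)) ∘ₐ X := by rw [hR2]; rfl
      _ = R ∘ₐ (a ∘ₐ X + (t : ℂ) • (b ∘ₐ X) + P ∘ₐ X) := by
        rw [← smul_comp, ← add_comp, ← add_comp]
        rfl
      _ = R ∘ₐ (A.adj ∘ₐ S.adj ∘ₐ S + (t : ℂ) • (A.adj ∘ₐ C)) := by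
        rw [hbX, hPX, add_zero, ← hAX]
        rfl
      _ = _ := by rw [comp_add, comp_smul]
  have hC : C = S.adj ∘ₐ S ∘ₐ V' ∘ₐ C := by
    change C = ((S.adj ∘ₐ S) ∘ₐ V') ∘ₐ C
    rw [hSV, one_comp]
  have hsub : (R - P) ∘ₐ A.adj ∘ₐ S.adj ∘ₐ S - X =
      -((t : ℂ) • ((R ∘ₐ A.adj ∘ₐ S.adj) ∘ₐ (S ∘ₐ V' ∘ₐ C))) := by
    have h1 : P ∘ₐ A.adj ∘ₐ S.adj ∘ₐ S = 0 :=
      (congrArg (· ∘ₐ (S.adj ∘ₐ S)) hPA).trans (zero_comp _)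
    have h2 : (R ∘ₐ A.adj ∘ₐ S.adj) ∘ₐ (S ∘ₐ V' ∘ₐ C) = R ∘ₐ A.adj ∘ₐ C := by
      nth_rw 2 [hC]
      rfl
    rw [sub_comp, h1, sub_zero, h2]
    nth_rw 1 [hX]
    abel
  have hag : a ≤ a + (t : ℂ) • b + P := by
    rw [add_assoc, Complex.coe_smul]
    exact le_add_of_nonneg_right (add_nonneg (smul_nonneg ht.le hb) hP)
  have hbound := sq_norm_resolvent_le (mul_pos ht hm) hlow hag hR1
  rw [hsub, norm_neg, norm_smul, Complex.norm_real, Real.norm_of_nonneg ht.le, mul_pow]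
  calc t ^ 2 * ‖(R ∘ₐ A.adj ∘ₐ S.adj) ∘ₐ (S ∘ₐ V' ∘ₐ C)‖ ^ 2
      ≤ t ^ 2 * (‖R ∘ₐ A.adj ∘ₐ S.adj‖ * ‖S ∘ₐ V' ∘ₐ C‖) ^ 2 := by
        gcongr
        exact norm_comp_le _ _
    _ = t ^ 2 * (‖R ∘ₐ A.adj ∘ₐ S.adj‖ ^ 2 * ‖S ∘ₐ V' ∘ₐ C‖ ^ 2) := by rw [mul_pow]
    _ ≤ t ^ 2 * ((t * m)⁻¹ * ‖S ∘ₐ V' ∘ₐ C‖ ^ 2) := by gcongr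
    _ = t * (m⁻¹ * ‖S ∘ₐ V' ∘ₐ C‖ ^ 2) := by
        field_simp

end Limit

section Decomposition

variable {𝔄 H K E : Type*} [NonUnitalCStarAlgebra 𝔄] [PartialOrder 𝔄] [StarOrderedRing 𝔄]
  [NormedAddCommGroup H] [NormedSpace ℂ H] [SMul 𝔄 H] [CStarModule 𝔄 H]
  [NormedAddCommGroup K] [NormedSpace ℂ K] [SMul 𝔄 K] [CStarModule 𝔄 K]
  [NormedAddCommGroup E] [NormedSpace ℂ E] [SMul 𝔄 E] [CStarModule 𝔄 E]
  {A : AdjointableOp 𝔄 H K} {B : AdjointableOp 𝔄 H E} {P Z : AdjointableOp 𝔄 H H}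

/-- The projection onto `𝓝(A) ∩ 𝓝(B)` is complementary to that onto `𝓡(A⋆ A + B⋆ B)`. -/
theorem IsProjOnto.eq_kernelProj (hP : P.IsProjOnto (A.nullSpace ⊓ B.nullSpace))
    (hZ : IsWMPInverse (one 𝔄 H) (one 𝔄 H) (A.adj ∘ₐ A + B.adj ∘ₐ B) Z) :
    P = 1 - Z ∘ₐ (A.adj ∘ₐ A + B.adj ∘ₐ B) := by
  set T := A.adj ∘ₐ A + B.adj ∘ₐ B with hT
  set F := 1 - Z ∘ₐ T with hF
  have hTP : T ∘ₐ P = 0 := by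
    refine ext_of_apply fun x => ?_
    have hA : A (P x) = 0 := (hP.apply_mem x).1
    have hB : B (P x) = 0 := (hP.apply_mem x).2
    rw [hT, add_comp, add_apply]
    simp [hA, hB]
  have hFP : F * P = P := by
    rw [hF, sub_mul, one_mul]
    change P - Z ∘ₐ T ∘ₐ P = P
    rw [hTP, comp_zero, sub_zero]
  have hPF : P * F = F := by
    refine ext_of_apply fun x => hP.apply_of_mem _ ?_
    exact apply_eq_zero_of_add_eq_zero
      (congrArg (fun R : AdjointableOp 𝔄 H H => R x) hZ.comp_kernelProj)
  have h := congrArg star hPF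
  rw [star_mul, show star P = P from hP.selfAdj, hZ.kernelProj_selfAdj] at h
  exact hFP.symm.trans h

end Decomposition

end AdjointableOp

open AdjointableOp in
theorem mainTheorem3 {𝔄 H K E : Type*}
    [NonUnitalCStarAlgebra 𝔄] [PartialOrder 𝔄] [StarOrderedRing 𝔄]
    [NormedAddCommGroup H] [NormedSpace ℂ H] [SMul 𝔄 H] [CStarModule 𝔄 H] [CompleteSpace H]
    [NormedAddCommGroup K] [NormedSpace ℂ K] [SMul 𝔄 K] [CStarModule 𝔄 K] [CompleteSpace K]
    [NormedAddCommGroup E] [NormedSpace ℂ E] [SMul 𝔄 E] [CStarModule 𝔄 E] [CompleteSpace E]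
    (A : AdjointableOp 𝔄 H K) (B : AdjointableOp 𝔄 H E)
    (hA : A.MPInvertible) (hAB : (A.adj ∘ₐ A + B.adj ∘ₐ B).MPInvertible)
    (V : AdjointableOp 𝔄 K K) (W : AdjointableOp 𝔄 E E)
    (hV : V.IsPosDef) (hW : W.IsPosDef)
    (U : AdjointableOp 𝔄 H H) (hU : U ∈ AdjointableOp.Omega A B W) :
    (∀ t : ℝ, 0 < t →
      (A.adj ∘ₐ V ∘ₐ A + (t : ℂ) • (B.adj ∘ₐ W ∘ₐ B)).MPInvertible) ∧
    U.IsPosDef ∧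
    AdjointableOp.WMPInvertible V U A ∧
    Tendsto
      (fun t : ℝ =>
        ((A.adj ∘ₐ V ∘ₐ A + (t : ℂ) • (B.adj ∘ₐ W ∘ₐ B)).mpInv ∘ₐ A.adj ∘ₐ V).toCLM)
      (𝓝[>] (0 : ℝ)) (𝓝 (AdjointableOp.wmpInv V U A).toCLM) := by
  obtain ⟨X₀, Y, P, hP, -, hGpos, hY, hUeq⟩ := hU
  obtain ⟨ZA, hZA⟩ := hA
  obtain ⟨Z, hZ⟩ := hAB
  have hPF := hP.eq_kernelProj hZ
  set T := A.adj ∘ₐ A + B.adj ∘ₐ B with hT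
  set G := A.adj ∘ₐ X₀ ∘ₐ A + B.adj ∘ₐ W ∘ₐ B with hG
  obtain ⟨T₀, hT₀, hT₀p⟩ := hGpos
  set b := B.adj ∘ₐ W ∘ₐ B with hb
  have hPs : star P = P := hP.selfAdj
  have hPP : P * P = P := hP.idem
  have hAP : A ∘ₐ P = 0 := ext_of_apply fun x => (hP.apply_mem x).1
  have hBP : B ∘ₐ P = 0 := ext_of_apply fun x => (hP.apply_mem x).2
  have hPA : P ∘ₐ A.adj = 0 := by
    have := congrArg adj hAP
    rwa [adj_comp, show P.adj = P from hPs] at this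
  have hGP : G ∘ₐ P = 0 := by
    rw [hG, add_comp]
    change (A.adj ∘ₐ X₀) ∘ₐ (A ∘ₐ P) + (B.adj ∘ₐ W) ∘ₐ (B ∘ₐ P) = 0
    rw [hAP, hBP, comp_zero, comp_zero, add_zero]
  have hT0 : 0 ≤ T := add_nonneg (nonneg_adj_comp_self A) (nonneg_adj_comp_self B)
  have hTZ : T ∘ₐ Z = Z ∘ₐ T := hZ.mul_comm_of_selfAdj hT0.isSelfAdjoint
  have hQ := hZ.isProjOnto_range
  have hQP : T ∘ₐ Z + P = 1 := by rw [hTZ, hPF, add_sub_cancel]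
  have hUdec : U = hQ.extend T₀ + hP.extend Y := by
    refine ext_of_apply fun x => ?_
    have h1 : G ((T ∘ₐ Z) x) = G x := by
      have : G ∘ₐ (T ∘ₐ Z) = G := by
        rw [eq_sub_of_add_eq hQP, comp_sub, hGP, sub_zero]
        rfl
      exact congrArg (fun R : AdjointableOp 𝔄 H H => R x) this
    rw [hUeq, ← h1]
    exact congrArg (· + _) (hT₀ ⟨(T ∘ₐ Z) x, hQ.apply_mem x⟩).symm
  have hUp : IsStrictlyPositive U := by
    rw [hUdec]
    exact hQ.isStrictlyPositive_extend_add_extend hP hQP hT₀p hY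
  have hUpd : U.IsPosDef := isPosDef_iff.mpr hUp
  have hVp := isPosDef_iff.mp hV
  have hWp := isPosDef_iff.mp hW
  obtain ⟨X, hX⟩ := hZA.wmpInvertible hVp hUp
  have hP0 : 0 ≤ P := nonneg_of_selfAdj_idem hPs hPP
  have hb0 : 0 ≤ b := conj_nonneg hWp.nonneg B
  have ha0 : 0 ≤ A.adj ∘ₐ V ∘ₐ A := conj_nonneg hVp.nonneg A
  have hTP : IsStrictlyPositive (T + P) := by
    rw [hPF]
    exact hZ.isStrictlyPositive_add_kernelProj hT0
  have hD1 : IsStrictlyPositive (A.adj ∘ₐ V ∘ₐ A + b + P) := by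
    obtain ⟨c, hc, hcV⟩ := hVp.exists_smul_one_le
    obtain ⟨d, hd, hdW⟩ := hWp.exists_smul_one_le
    refine hTP.add_of_smul_le hT0 hP0 (lt_min hc hd) ?_
    rw [hT, smul_add]
    exact add_le_add
      ((smul_le_smul_of_nonneg_right (min_le_left c d) (nonneg_adj_comp_self A)).trans
        (smul_gram_le_conj hcV A))
      ((smul_le_smul_of_nonneg_right (min_le_right c d) (nonneg_adj_comp_self B)).trans
        (smul_gram_le_conj hdW B))
  obtain ⟨m, hm, hmD⟩ := hD1.exists_smul_one_le
  have hlow (t : ℝ) (ht : 0 < t) : (min t 1 * m) • (1 : AdjointableOp 𝔄 H H) ≤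
      A.adj ∘ₐ V ∘ₐ A + (t : ℂ) • b + P := by
    have hmin : 0 ≤ min t 1 := (lt_min ht one_pos).le
    have hle {x : AdjointableOp 𝔄 H H} (hx : 0 ≤ x) : min t 1 • x ≤ x := by
      simpa using smul_le_smul_of_nonneg_right (min_le_right t 1) hx
    rw [mul_smul, Complex.coe_smul]
    refine (smul_le_smul_of_nonneg_left hmD hmin).trans ?_
    rw [smul_add, smul_add]
    exact add_le_add (add_le_add (hle ha0)
      (smul_le_smul_of_nonneg_right (min_le_left t 1) hb0)) (hle hP0)
  have hMP (t : ℝ) (ht : 0 < t) : ∃ R : AdjointableOp 𝔄 H H,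
      (A.adj ∘ₐ V ∘ₐ A + (t : ℂ) • b + P) * R = 1 ∧
      R * (A.adj ∘ₐ V ∘ₐ A + (t : ℂ) • b + P) = 1 ∧
      IsWMPInverse (one 𝔄 H) (one 𝔄 H) (A.adj ∘ₐ V ∘ₐ A + (t : ℂ) • b) (R - P) := by
    obtain ⟨R, hR1, hR2⟩ := isUnit_iff_exists.mp (IsStrictlyPositive.of_smul_one_le
      (mul_pos (lt_min ht one_pos) hm) (hlow t ht)).isUnit
    refine ⟨R, hR1, hR2, isWMPInverse_sub_of_add ?_ hPs hPP ?_ hR1 hR2⟩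
    · rw [Complex.coe_smul]
      exact (add_nonneg ha0 (smul_nonneg ht.le hb0)).isSelfAdjoint
    · rw [add_mul, smul_mul_assoc]
      change (A.adj ∘ₐ V) ∘ₐ (A ∘ₐ P) + (t : ℂ) • ((B.adj ∘ₐ W) ∘ₐ (B ∘ₐ P)) = 0
      rw [hAP, hBP, comp_zero, comp_zero, smul_zero, add_zero]
  have hUX := hX.weight_comp_eq hUpd.1.1
  have hPX : P ∘ₐ X = 0 := by
    have hUP' : U * P = hP.extend Y := by
      have e1 : hP.extend Y * P = hP.extend Y := by
        nth_rw 2 [← hP.extend_one]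
        rw [hP.extend_mul_extend, mul_one]
      have e2 : hQ.extend T₀ * P = 0 := by
        refine (congrArg (hQ.extend T₀ * ·) hP.extend_one.symm).trans
          (hQ.extend_mul_extend_eq_zero hP ?_ _ _)
        rw [eq_sub_of_add_eq hQP, sub_mul, one_mul, hPP, sub_self]
      rw [hUdec, add_mul, e1, e2, zero_add]
    have hcomm : U * P = P * U := by
      have h : star (U * P) = U * P := by
        rw [hUP']
        exact (hP.extend_nonneg hY.2).isSelfAdjoint
      rw [← h, star_mul, hPs, hUp.isSelfAdjoint.star_eq]
    obtain ⟨U', hU', -⟩ := hUpd.1.2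
    calc P ∘ₐ X = (U' ∘ₐ U) ∘ₐ P ∘ₐ X := by rw [hU', one_comp]
      _ = U' ∘ₐ (U * P) ∘ₐ X := rfl
      _ = U' ∘ₐ P ∘ₐ U ∘ₐ X := by rw [hcomm]; rfl
      _ = U' ∘ₐ (P ∘ₐ A.adj) ∘ₐ X.adj ∘ₐ U ∘ₐ X :=
        congrArg (fun R => U' ∘ₐ P ∘ₐ R) hUX.symm
      _ = 0 := by rw [hPA, zero_comp, comp_zero]
  have hbX : b ∘ₐ X = A.adj ∘ₐ (X.adj ∘ₐ U ∘ₐ X - X₀ ∘ₐ A ∘ₐ X) := by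
    have hGU : U ∘ₐ X = G ∘ₐ X := by
      refine ext_of_apply fun y => ?_
      have h0 : P (X y) = 0 := congrArg (fun R : AdjointableOp 𝔄 K H => R y) hPX
      have h1 : (⟨P (X y), hP.apply_mem (X y)⟩ :
          (A.nullSpace ⊓ B.nullSpace).toSubmodule) = 0 := Subtype.ext h0
      rw [comp_apply, hUeq, h1, map_zero]
      exact add_zero _
    rw [comp_sub, hUX, hGU, hG, add_comp]
    exact (add_sub_cancel_left _ _).symm
  obtain ⟨S, hS⟩ := hV.2
  obtain ⟨V', -, hV'⟩ := hV.1.2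
  have hAX := hX.adj_comp_eq hV.1.1
  refine ⟨fun t ht => (hMP t ht).elim fun R h => ⟨R - P, h.2.2⟩, hUpd, ⟨X, hX⟩, ?_⟩
  rw [hX.wmpInv_eq hV.1 hUpd.1, tendsto_iff_norm_sub_tendsto_zero]
  set κ := m⁻¹ * ‖S ∘ₐ V' ∘ₐ (X.adj ∘ₐ U ∘ₐ X - X₀ ∘ₐ A ∘ₐ X)‖ ^ 2
  have hlim : Tendsto (fun t : ℝ => √(t * κ)) (𝓝[>] 0) (𝓝 0) := by
    have : Continuous fun t : ℝ => √(t * κ) := by fun_prop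
    simpa using (this.tendsto 0).mono_left nhdsWithin_le_nhds
  refine squeeze_zero' (Eventually.of_forall fun t => norm_nonneg _) ?_ hlim
  filter_upwards [Ioo_mem_nhdsGT (zero_lt_one (α := ℝ))] with t ht
  obtain ⟨R, hR1, hR2, hR⟩ := hMP t ht.1
  have hl := hlow t ht.1
  rw [min_eq_left ht.2.le] at hl
  rw [mpInv, hR.wmpInv_eq isWeight_one isWeight_one]
  subst hS
  exact Real.le_sqrt_of_sq_le
    (sq_norm_regularised_sub_le hV' hAX hbX hPX hPA hb0 hP0 ht.1 hm hl hR1 hR2)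

end
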